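/- Let $V=\mathbb{C}^{n+1}$, let $\mathbb{P}V$ be the projective space of lines in $V$, and let $L=\mathcal{O}(d)$ on $\mathbb{P}V$, so that $H^0(L)=S^dV^*$ and $S^dV=H^0(L)^*$, where $v^d$ is the functional $g\mapsto g(v)$. For $f\in S^dV$, a Waring decomposition is an expression $f=\sum_{i=1}^r c_iv_i^d$ with $c_i\in\mathbb{C}$ and $0\neq v_i\in V$; the least possible $r$ is $\operatorname{rank}(f)$, and the decomposition is minimal if $r=\operatorname{rank}(f)$. Two decompositions are considered equal if they agree up to the order of the summands and the rescaling of the $v_i$. Let $E$ be an algebraic vector bundle of positive rank on $\mathbb{P}V$, and let $A_f\colon H^0(E)\to H^0(E^*\otimes L)^*$ be given by $A_f(s)(t)=f(\langle s,t\rangle)$, where $\langle\cdot,\cdot\rangle\colon H^0(E)\otimes H^0(E^*\otimes L)\to H^0(L)$ is the contraction. Let $Z'\subset\mathbb{P}V$ be the base locus of $\ker A_f$, i.e. the common zero locus of all sections in $\ker A_f$. It has the scheme structure defined locally by the ideal that the components of these sections generate. The general algorithm, with input $f$ and $E$, is the following. (1) Construct $A_f$. (2) Compute $\ker A_f$; if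 it is $0$, stop: the method fails. (3) Find the base locus $Z'$ of $\ker A_f$; if it does not consist of finitely many reduced points, stop: the method fails. (4) Otherwise write $Z'=\{[v_1],\dots,[v_s]\}$ and solve the linear system $f=\sum_{i=1}^s c_iv_i^d$ in the unknowns $c_1,\dots,c_s$. The output is the set of solutions. Theorem. Assume that $\operatorname{rank}(f)=\operatorname{rank}(A_f)/\operatorname{rank}(E)$. (a) For every minimal decomposition $f=\sum_{i=1}^rc_iv_i^d$, the set $Z=\{[v_1],\dots,[v_r]\}$ is contained in $Z'$. (b) Suppose that $Z'$ is a finite set $\{[v_1],\dots,[v_s]\}$ (reduced or not). Then the linear system $f=\sum_{i=1}^s c_iv_i^d$ yields all minimal Waring decompositions of $f$: its solutions with the fewest nonzero coefficients correspond to the minimal Waring decompositions of $f$, each minimal decomposition being given by exactly one such solution, and each such solution giving a minimal decomposition. In particular, if the linear system has a unique solution, then $f$ has a unique minimal Waring decomposition and the solution gives it; and if $f$ has a unique minimal Waring decomposition, then the linear system has exactly one solution with the fewest nonzero coefficients, and it gives this decomposition. (c) If $n\geq 1$ and $Z'$ consists of finitely many reduced points, then the general algorithm does not fail, and its output is the solution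 set of the linear system in (b); hence it produces all minimal Waring decompositions of $f$, and the unique one when it is unique. -/

import Mathlib

open MvPolynomial

open scoped LinearAlgebra.Projectivization

noncomputable section

namespace Waring

/-! ## Forms, Waring decompositions and Waring rank

The space `V` is `ℂ^(n+1)` with basis `x₀, …, xₙ`.  An element of `S^d V` is a homogeneous
polynomial of degree `d` in the variables `x₀, …, xₙ`, and a vector `v ∈ V` is identified with
the linear form `∑ i, v i * x i`.  The projective space `ℙ V` is the space of lines in `V`. -/

/-- The vector space `V = ℂ^(n+1)`. -/
abbrev Vec (n : ℕ) : Type := Fin (n + 1) → ℂ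

/-- The projective space of lines in `V = ℂ^(n+1)`. -/
abbrev PSpace (n : ℕ) : Type := ℙ ℂ (Vec n)

/-- The vector `v ∈ V`, seen as the element `∑ i, v i * x i` of `S^1 V`. -/
def linForm {n : ℕ} (v : Vec n) : MvPolynomial (Fin (n + 1)) ℂ := ∑ i, C (v i) * X i

/-- `f = ∑ i, c i * (v i)^d`, with `r` summands and nonzero vectors `v i`. -/
def IsWaringDecomp {n : ℕ} (d : ℕ) (f : MvPolynomial (Fin (n + 1)) ℂ) {r : ℕ}
    (c : Fin r → ℂ) (v : Fin r → Vec n) : Prop :=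
  (∀ i, v i ≠ 0) ∧ f = ∑ i, C (c i) * linForm (v i) ^ d

/-- The (symmetric) rank of `f ∈ S^d V`: the least number of summands in a decomposition. -/
def waringRank {n : ℕ} (d : ℕ) (f : MvPolynomial (Fin (n + 1)) ℂ) : ℕ :=
  sInf {r : ℕ | ∃ (c : Fin r → ℂ) (v : Fin r → Vec n), IsWaringDecomp d f c v}

/-- Two decompositions coincide up to the order of the summands and up to the rescaling of the
vectors: after a permutation they have the same points `[v i]` and the same summands. -/
def SameDecomp {n : ℕ} (d : ℕ) {r : ℕ} (c : Fin r → ℂ) (v : Fin r → Vec n)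
    (c' : Fin r → ℂ) (v' : Fin r → Vec n) : Prop :=
  ∃ e : Equiv.Perm (Fin r), ∀ i,
    (∃ (h : v i ≠ 0) (h' : v' (e i) ≠ 0),
      Projectivization.mk ℂ (v i) h = Projectivization.mk ℂ (v' (e i)) h') ∧
    C (c i) * linForm (v i) ^ d = C (c' (e i)) * linForm (v' (e i)) ^ d

/-! ## Zariski open sets and regular functions -/

/-- The cone (without the origin) over a set of points of the projective space. -/
def coneOver {n : ℕ} (U : Set (PSpace n)) : Set (Vec n) :=
  {v | ∃ h : v ≠ 0, Projectivization.mk ℂ v h ∈ U}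

/-- Zariski open sets: every point has a neighbourhood `{q ≠ 0}`, with `q` a form,
that is contained in the set. -/
def IsZariskiOpen {n : ℕ} (U : Set (PSpace n)) : Prop :=
  ∀ v ∈ coneOver U, ∃ (k : ℕ) (q : MvPolynomial (Fin (n + 1)) ℂ), q.IsHomogeneous k ∧
    eval v q ≠ 0 ∧ ∀ w : Vec n, w ≠ 0 → eval w q ≠ 0 → w ∈ coneOver U

/-- `s` is a section of `𝒪(d)` over `U`, i.e. a function on the cone over `U` that is locally a
quotient of two forms whose degrees differ by `d`.  For `d = 0` this says that `s` is a regular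
function on `U`.  The values of `s` outside the cone over `U` play no role. -/
def IsRegularOn {n : ℕ} (d : ℕ) (U : Set (PSpace n)) (s : Vec n → ℂ) : Prop :=
  ∀ v ∈ coneOver U, ∃ (k : ℕ) (p q : MvPolynomial (Fin (n + 1)) ℂ),
    p.IsHomogeneous (k + d) ∧ q.IsHomogeneous k ∧ eval v q ≠ 0 ∧
      ∀ w ∈ coneOver U, eval w q ≠ 0 → s w = eval w p / eval w q

theorem coneOver_univ {n : ℕ} {v : Vec n} :
    v ∈ coneOver (Set.univ : Set (PSpace n)) ↔ v ≠ 0 := by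
  simp [coneOver]

theorem coneOver_inter {n : ℕ} {U W : Set (PSpace n)} {v : Vec n} :
    v ∈ coneOver (U ∩ W) ↔ v ∈ coneOver U ∧ v ∈ coneOver W := by
  constructor
  · rintro ⟨h, h1, h2⟩
    exact ⟨⟨h, h1⟩, ⟨h, h2⟩⟩
  · rintro ⟨⟨h, h1⟩, ⟨_, h2⟩⟩
    exact ⟨h, h1, h2⟩

namespace IsRegularOn

variable {n d e : ℕ} {U : Set (PSpace n)} {s t : Vec n → ℂ}

theorem zero : IsRegularOn d U (fun _ => 0) := fun v _ =>
  ⟨0, 0, 1, isHomogeneous_zero _ _ _, isHomogeneous_one _ _, by simp, by simp⟩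

theorem add (hs : IsRegularOn d U s) (ht : IsRegularOn d U t) :
    IsRegularOn d U (fun v => s v + t v) := by
  intro v hv
  obtain ⟨k, p, q, hp, hq, hqv, h⟩ := hs v hv
  obtain ⟨k', p', q', hp', hq', hqv', h'⟩ := ht v hv
  refine ⟨k + k', p * q' + q * p', q * q', ?_, hq.mul hq', ?_, ?_⟩
  · refine IsHomogeneous.add ?_ ?_
    · have := hp.mul hq'
      rwa [show k + d + k' = k + k' + d by omega] at this
    · have := hq.mul hp'
      rwa [show k + (k' + d) = k + k' + d by omega] at this
  · simpa using ⟨hqv, hqv'⟩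
  · intro w hw hne
    rw [map_mul] at hne
    have h1 := left_ne_zero_of_mul hne
    have h2 := right_ne_zero_of_mul hne
    simp only [h w hw h1, h' w hw h2, map_add, map_mul]
    rw [div_add_div _ _ h1 h2]

theorem mul (hs : IsRegularOn d U s) (ht : IsRegularOn e U t) :
    IsRegularOn (d + e) U (fun v => s v * t v) := by
  intro v hv
  obtain ⟨k, p, q, hp, hq, hqv, h⟩ := hs v hv
  obtain ⟨k', p', q', hp', hq', hqv', h'⟩ := ht v hv
  refine ⟨k + k', p * p', q * q', ?_, hq.mul hq', ?_, ?_⟩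
  · have := hp.mul hp'
    rwa [show k + d + (k' + e) = k + k' + (d + e) by omega] at this
  · simpa using ⟨hqv, hqv'⟩
  · intro w hw hne
    rw [map_mul] at hne
    have h1 := left_ne_zero_of_mul hne
    have h2 := right_ne_zero_of_mul hne
    simp only [h w hw h1, h' w hw h2, map_mul]
    rw [div_mul_div_comm]

theorem const_mul (a : ℂ) (hs : IsRegularOn d U s) : IsRegularOn d U (fun v => a * s v) := by
  intro v hv
  obtain ⟨k, p, q, hp, hq, hqv, h⟩ := hs v hv
  refine ⟨k, C a * p, q, hp.C_mul a, hq, hqv, ?_⟩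
  intro w hw hne
  simp only [h w hw hne, map_mul, eval_C, mul_div_assoc]

theorem sum {ι : Type*} (A : Finset ι) {s : ι → Vec n → ℂ} (hs : ∀ i, IsRegularOn d U (s i)) :
    IsRegularOn d U (fun v => ∑ i ∈ A, s i v) := by
  classical
  induction A using Finset.induction_on with
  | empty => simpa using zero
  | insert a A ha ih =>
    simp only [Finset.sum_insert ha]
    exact (hs a).add ih

theorem mono {W : Set (PSpace n)} (hW : W ⊆ U) (hs : IsRegularOn d U s) :
    IsRegularOn d W s := by
  have hc : ∀ v ∈ coneOver W, v ∈ coneOver U := fun v ⟨h, hv⟩ => ⟨h, hW hv⟩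
  intro v hv
  obtain ⟨k, p, q, hp, hq, hqv, h⟩ := hs v (hc v hv)
  exact ⟨k, p, q, hp, hq, hqv, fun w hw => h w (hc w hw)⟩

end IsRegularOn

/-! ## Global sections of `L = 𝒪(d)` and the identification `S^d V = H⁰(L)^*` -/

/-- `H⁰(𝒪(d))`: the functions on `V ∖ {0}`, extended by `0` to the origin, that are locally
quotients of two forms whose degrees differ by `d`. -/
def globalO (n d : ℕ) : Submodule ℂ (Vec n → ℂ) where
  carrier := {s | s 0 = 0 ∧ IsRegularOn d Set.univ s}
  zero_mem' := ⟨rfl, IsRegularOn.zero⟩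
  add_mem' := by
    rintro s t ⟨hs0, hs⟩ ⟨ht0, ht⟩
    exact ⟨by simp [hs0, ht0], hs.add ht⟩
  smul_mem' := by
    rintro a s ⟨hs0, hs⟩
    exact ⟨by simp [hs0], hs.const_mul a⟩

/-- A form of degree `d` on `V`, seen as a global section of `𝒪(d)`. -/
def formToSection (n d : ℕ) : homogeneousSubmodule (Fin (n + 1)) ℂ d →ₗ[ℂ] globalO n d where
  toFun g := ⟨fun v => if v = 0 then 0 else eval v g.1, by
    refine ⟨by simp, ?_⟩
    intro v _
    refine ⟨0, g.1, 1, by rw [zero_add]; exact g.2, isHomogeneous_one _ _, by simp, ?_⟩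
    intro w hw _
    rw [coneOver_univ] at hw
    simp [hw]⟩
  map_add' g h := by
    ext v
    by_cases hv : v = 0 <;> simp [hv]
  map_smul' a g := by
    ext v
    by_cases hv : v = 0 <;> simp [hv]

theorem formToSection_apply {n d : ℕ} (g : homogeneousSubmodule (Fin (n + 1)) ℂ d) {v : Vec n}
    (hv : v ≠ 0) : (formToSection n d g).1 v = eval v g.1 := by
  simp [formToSection, hv]

theorem eq_of_eval_eq {n : ℕ} {a b : MvPolynomial (Fin (n + 1)) ℂ}
    (h : ∀ v : Vec n, v ≠ 0 → eval v a = eval v b) : a = b := by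
  have hX : (X 0 : MvPolynomial (Fin (n + 1)) ℂ) ≠ 0 := X_ne_zero 0
  refine mul_left_cancel₀ hX (MvPolynomial.funext fun v => ?_)
  by_cases hv : v = 0
  · simp [hv]
  · simp [h v hv]

theorem formToSection_injective (n d : ℕ) : Function.Injective (formToSection n d) := by
  intro g h hgh
  refine Subtype.ext (eq_of_eval_eq fun v hv => ?_)
  rw [← formToSection_apply g hv, ← formToSection_apply h hv, hgh]

/-- A global section of `𝒪(d)` that agrees with some polynomial is given by a form of
degree `d`. -/
theorem exists_form_of_polynomial {n d : ℕ} (s : globalO n d)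
    (g : MvPolynomial (Fin (n + 1)) ℂ) (hg : ∀ v : Vec n, v ≠ 0 → s.1 v = eval v g) :
    ∃ g' : homogeneousSubmodule (Fin (n + 1)) ℂ d, formToSection n d g' = s := by
  classical
  obtain ⟨k, p, q, hp, hq, hqv, h⟩ := s.2.2 (fun _ => 1)
    (coneOver_univ.2 (by intro h0; simpa using congrFun h0 0))
  have hq0 : q ≠ 0 := by
    rintro rfl
    simp at hqv
  have h1 : q * (q * g) = q * p := by
    refine eq_of_eval_eq fun w hw => ?_
    by_cases hqw : eval w q = 0
    · simp [hqw]
    · have := h w (coneOver_univ.2 hw) hqw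
      rw [hg w hw, eq_div_iff hqw] at this
      simp only [map_mul]
      rw [← this]
      ring
  have h2 : q * g = p := mul_left_cancel₀ hq0 h1
  have h3 : homogeneousComponent (k + d) (q * g) = q * homogeneousComponent d g := by
    let _ := MvPolynomial.gradedAlgebra (σ := Fin (n + 1)) (R := ℂ)
    have h := DirectSum.coe_decompose_mul_add_of_left_mem (homogeneousSubmodule (Fin (n + 1)) ℂ)
      (i := k) (j := d) (b := g) hq
    have e : ∀ (m : ℕ) (x : MvPolynomial (Fin (n + 1)) ℂ),
        (DirectSum.decompose (homogeneousSubmodule (Fin (n + 1)) ℂ) x m : MvPolynomial _ ℂ) =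
          homogeneousComponent m x := fun m x => decomposition.decompose'_apply x m
    rwa [e, e] at h
  rw [h2, homogeneousComponent_eq_self hp, ← h2] at h3
  have h4 : g = homogeneousComponent d g := mul_left_cancel₀ hq0 h3
  refine ⟨⟨g, by rw [h4]; exact homogeneousComponent_mem _ _⟩, ?_⟩
  ext v
  by_cases hv : v = 0
  · subst hv
    rw [s.2.1]
    simp [formToSection]
  · rw [formToSection_apply _ hv, hg v hv]

/-- Every global section of `𝒪(d)` is given by a form of degree `d`. -/
theorem formToSection_surjective (n d : ℕ) : Function.Surjective (formToSection n d) := by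
  intro s
  have hloc : ∀ v : Vec n, v ≠ 0 → ∃ (k : ℕ) (p q : MvPolynomial (Fin (n + 1)) ℂ),
      p.IsHomogeneous (k + d) ∧ q.IsHomogeneous k ∧ eval v q ≠ 0 ∧
      ∀ w : Vec n, w ≠ 0 → eval w q ≠ 0 → s.1 w = eval w p / eval w q := by
    intro v hv
    obtain ⟨k, p, q, hp, hq, hqv, h⟩ := s.2.2 v (coneOver_univ.2 hv)
    exact ⟨k, p, q, hp, hq, hqv, fun w hw => h w (coneOver_univ.2 hw)⟩
  -- the ideal of the denominators of the section
  let I : Ideal (MvPolynomial (Fin (n + 1)) ℂ) :=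
    { carrier := {h | ∃ p, ∀ w : Vec n, w ≠ 0 → eval w h * s.1 w = eval w p}
      zero_mem' := ⟨0, by simp⟩
      add_mem' := by
        rintro a b ⟨p, hp⟩ ⟨p', hp'⟩
        refine ⟨p + p', fun w hw => ?_⟩
        rw [map_add, map_add, add_mul, hp w hw, hp' w hw]
      smul_mem' := by
        rintro c a ⟨p, hp⟩
        refine ⟨c * p, fun w hw => ?_⟩
        rw [smul_eq_mul, map_mul, map_mul, mul_assoc, hp w hw] }
  have hX : ∀ i, ∃ N : ℕ, (X i : MvPolynomial (Fin (n + 1)) ℂ) ^ N ∈ I := by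
    intro i
    have hrad : (X i : MvPolynomial (Fin (n + 1)) ℂ) ∈ I.radical := by
      rw [← vanishingIdeal_zeroLocus_eq_radical (K := ℂ) I, mem_vanishingIdeal_iff]
      intro v hv
      have hv0 : v = 0 := by
        by_contra hne
        obtain ⟨k, p, q, -, -, hqv, h⟩ := hloc v hne
        have hmem : q * q ∈ I := by
          refine ⟨q * p, fun w hw => ?_⟩
          by_cases hqw : eval w q = 0
          · simp [hqw]
          · rw [h w hw hqw]
            simp only [map_mul]
            field_simp
        have := hv _ hmem
        rw [aeval_eq_eval] at this
        exact hqv (by simpa using this)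
      simp [hv0]
    exact hrad
  suffices hpoly : ∃ g, ∀ v : Vec n, v ≠ 0 → s.1 v = eval v g by
    obtain ⟨g, hg⟩ := hpoly
    exact exists_form_of_polynomial s g hg
  choose N p hp using hX
  rcases Nat.eq_zero_or_pos n with rfl | hn
  · -- one variable: a form is determined by its value at one point
    obtain ⟨k, a, b, ha, hb, hb1, h⟩ := hloc (fun _ => 1)
      (by intro h0; simpa using congrFun h0 0)
    have key : ∀ (m : ℕ) (g : MvPolynomial (Fin (0 + 1)) ℂ), g.IsHomogeneous m →
        ∀ v : Vec 0, eval v g = v 0 ^ m * eval (fun _ => 1) g := by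
      intro m g hg v
      rw [eval_eq', eval_eq', Finset.mul_sum]
      refine Finset.sum_congr rfl fun x hx => ?_
      have h0 : x 0 = m := by
        have hdeg := hg.degree_eq_sum_deg_support hx
        rw [hdeg, Finset.sum_eq_single 0]
        · intro i _ hi
          exact absurd (Fin.fin_one_eq_zero i) hi
        · intro hnot
          simpa using hnot
      rw [Fin.prod_univ_one, Fin.prod_univ_one, h0]
      ring
    refine ⟨C (eval (fun _ => 1) a / eval (fun _ => 1) b) * X 0 ^ d, fun v hv => ?_⟩
    have hv0 : v 0 ≠ 0 := by
      intro h0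
      refine hv (funext fun i => ?_)
      rw [Fin.fin_one_eq_zero i]
      exact h0
    rw [h v hv (by rw [key k b hb v]; exact mul_ne_zero (pow_ne_zero _ hv0) hb1),
      key _ a ha v, key _ b hb v]
    simp only [map_mul, map_pow, eval_C, eval_X]
    field_simp
    ring
  · have h01 : (0 : Fin (n + 1)) ≠ Fin.last n := by
      intro h0
      have := congrArg Fin.val h0
      simp at this
      omega
    have hswap : ∀ i j, (X i : MvPolynomial (Fin (n + 1)) ℂ) ^ N i * p j = X j ^ N j * p i := by
      intro i j
      refine eq_of_eval_eq fun w hw => ?_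
      rw [map_mul, map_mul, ← hp i w hw, ← hp j w hw]
      ring
    have hdvd : (X 0 : MvPolynomial (Fin (n + 1)) ℂ) ^ N 0 ∣ p 0 := by
      have hpr : Prime (X 0 : MvPolynomial (Fin (n + 1)) ℂ) := X_prime
      refine hpr.pow_dvd_of_dvd_mul_left (N 0) (a := X (Fin.last n) ^ N (Fin.last n)) ?_
        ⟨_, (hswap 0 (Fin.last n)).symm⟩
      intro hd
      exact h01 (X_dvd_X.1 (hpr.dvd_of_dvd_pow hd))
    obtain ⟨g, hg⟩ := hdvd
    refine ⟨g, fun v hv => ?_⟩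
    obtain ⟨j, hj⟩ : ∃ j, v j ≠ 0 := by
      by_contra hcon
      push Not at hcon
      exact hv (funext hcon)
    have hpj : p j = X j ^ N j * g := by
      have := hswap 0 j
      rw [hg] at this
      refine mul_left_cancel₀ (pow_ne_zero (N 0) (X_ne_zero (0 : Fin (n + 1)))) ?_
      rw [this]
      ring
    have h1 := hp j v hv
    rw [hpj] at h1
    simp only [map_mul, map_pow, eval_X] at h1
    exact mul_left_cancel₀ (pow_ne_zero _ hj) h1

/-- The identification of `H⁰(𝒪(d))` with the space `S^d V^*` of forms of degree `d` on `V`. -/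
def sectionEquivForm (n d : ℕ) :
    globalO n d ≃ₗ[ℂ] homogeneousSubmodule (Fin (n + 1)) ℂ d :=
  (LinearEquiv.ofBijective (formToSection n d)
    ⟨formToSection_injective n d, formToSection_surjective n d⟩).symm

/-- The natural pairing of `S^d V` with `S^d V^*`; it is determined by `⟨v^d, g⟩ = g(v)`, which
is the theorem `apolar_pow` below. -/
def apolar (n d : ℕ) (f : MvPolynomial (Fin (n + 1)) ℂ) :
    homogeneousSubmodule (Fin (n + 1)) ℂ d →ₗ[ℂ] ℂ where
  toFun g := ∑ α ∈ Finset.finsuppAntidiag Finset.univ d,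
    (α.multinomial : ℂ)⁻¹ * coeff α f * coeff α g.1
  map_add' g h := by
    simp [mul_add, Finset.sum_add_distrib]
  map_smul' a g := by
    simp only [Submodule.coe_smul, coeff_smul, smul_eq_mul, RingHom.id_apply, Finset.mul_sum]
    exact Finset.sum_congr rfl fun _ _ => by ring

theorem apolar_pow {n d : ℕ} (v : Vec n) (g : homogeneousSubmodule (Fin (n + 1)) ℂ d) :
    apolar n d (linForm v ^ d) g = eval v g.1 := by
  have hlin : linForm v = ∑ i, v i • (X i : MvPolynomial (Fin (n + 1)) ℂ) := by
    simp [linForm, smul_eq_C_mul]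
  have hmem : ∀ α : Fin (n + 1) →₀ ℕ, α ∈ Finset.finsuppAntidiag Finset.univ d ↔
      α.degree = d := by
    intro α
    simp [Finset.mem_finsuppAntidiag, Finsupp.degree_eq_sum]
  rw [eval_eq']
  symm
  refine Finset.sum_subset_zero_on_sdiff ?_ ?_ ?_
  · intro α hα
    rw [hmem]
    by_contra hne
    exact (mem_support_iff.1 hα) (IsHomogeneous.coeff_eq_zero g.2 hne)
  · intro α hα
    rw [Finset.mem_sdiff, mem_support_iff, not_not] at hα
    rw [hα.2, mul_zero]
  · intro α hα
    have hdeg : α.degree = d := by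
      by_contra hne
      exact (mem_support_iff.1 hα) (IsHomogeneous.coeff_eq_zero g.2 hne)
    have hm : (α.multinomial : ℂ) ≠ 0 := by
      rw [Finsupp.multinomial_eq]
      exact_mod_cast (Nat.multinomial_pos _ _).ne'
    rw [hlin,
      coeff_linearCombination_X_pow_of_fintype, if_pos (show (α.sum fun _ m => m) = d from hdeg),
      Finsupp.prod_fintype _ _ (by simp), inv_mul_cancel_left₀ hm]
    ring

/-- The element of `H⁰(L)^*`, with `L = 𝒪(d)`, that corresponds to `f ∈ S^d V`. -/
def toDual (n d : ℕ) (f : MvPolynomial (Fin (n + 1)) ℂ) : Module.Dual ℂ (globalO n d) :=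
  (apolar n d f).comp (sectionEquivForm n d).toLinearMap

/-! ## Algebraic vector bundles on the projective space -/

/-- An algebraic vector bundle on `ℙ V`, given by an arbitrary Zariski open trivializing cover
and regular transition matrices satisfying the cocycle condition.  As functions on cones, the
transition matrices are invariant under rescaling because their entries are regular. -/
structure AlgBundle (n : ℕ) where
  /-- The index set of the cover. -/
  ι : Type
  /-- The cover. -/
  U : ι → Set (PSpace n)
  isOpen : ∀ i, IsZariskiOpen (U i)
  cover : ∀ z : PSpace n, ∃ i, z ∈ U i
  /-- The rank of the bundle. -/
  rank : ℕ
  /-- The transition matrices: sections transform by `s i = g i j *ᵥ s j`. -/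
  g : ι → ι → Vec n → Matrix (Fin rank) (Fin rank) ℂ
  regular : ∀ i j a b, IsRegularOn 0 (U i ∩ U j) (fun v => g i j v a b)
  g_self : ∀ i, ∀ v ∈ coneOver (U i), g i i v = 1
  cocycle : ∀ i j k, ∀ v ∈ coneOver (U i ∩ U j ∩ U k), g i j v * g j k v = g i k v

namespace AlgBundle

variable {n : ℕ} (E : AlgBundle n)

/-- The dual bundle `E^*`, with the inverse transpose transition matrices. -/
@[reducible] def dual : AlgBundle n where
  ι := E.ι
  U := E.U
  isOpen := E.isOpen
  cover := E.cover
  rank := E.rank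
  g i j v := (E.g j i v).transpose
  regular i j a b := (E.regular j i b a).mono (Set.inter_comm _ _).subset
  g_self i v hv := by rw [E.g_self i v hv, Matrix.transpose_one]
  cocycle i j k v hv := by
    rw [← Matrix.transpose_mul, E.cocycle k j i v]
    rw [show E.U k ∩ E.U j ∩ E.U i = E.U i ∩ E.U j ∩ E.U k by
      ext; simp only [Set.mem_inter_iff]; tauto]
    exact hv

/-- `H⁰(E ⊗ 𝒪(d))`: in the trivialization of `E` over `U i` a section is a column of sections of
`𝒪(d)` over `U i` (extended by `0`), and the columns are related by the transition matrices of
`E`.  For `d = 0` this is `H⁰(E)`. -/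
def sections (d : ℕ) : Submodule ℂ (E.ι → Vec n → Fin E.rank → ℂ) where
  carrier := {s | (∀ i a, IsRegularOn d (E.U i) (fun v => s i v a)) ∧
    (∀ i, ∀ v ∉ coneOver (E.U i), s i v = 0) ∧
    ∀ i j, ∀ v ∈ coneOver (E.U i ∩ E.U j), s i v = (E.g i j v).mulVec (s j v)}
  zero_mem' := ⟨fun _ _ => IsRegularOn.zero, fun _ _ _ => rfl, fun _ _ _ _ => by simp⟩
  add_mem' := by
    rintro s t ⟨h1, h2, h3⟩ ⟨h1', h2', h3'⟩
    refine ⟨fun i a => (h1 i a).add (h1' i a), fun i v hv => ?_, fun i j v hv => ?_⟩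
    · simp [h2 i v hv, h2' i v hv]
    · simp only [Pi.add_apply]
      rw [Matrix.mulVec_add, ← h3 i j v hv, ← h3' i j v hv]
  smul_mem' := by
    rintro a s ⟨h1, h2, h3⟩
    refine ⟨fun i b => (h1 i b).const_mul a, fun i v hv => ?_, fun i j v hv => ?_⟩
    · simp [h2 i v hv]
    · simp only [Pi.smul_apply]
      rw [Matrix.mulVec_smul, ← h3 i j v hv]

/-- An index of a member of the cover that contains the point `z`. -/
def idx (z : PSpace n) : E.ι := (E.cover z).choose

theorem idx_mem (z : PSpace n) : z ∈ E.U (E.idx z) := (E.cover z).choose_spec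

open Classical in
/-- The contraction of `s ∈ H⁰(E)` with `t ∈ H⁰(E^* ⊗ 𝒪(d))`, as a function on `V ∖ {0}`
(extended by `0`).  It does not depend on the trivialization: see `contractFun_eq`. -/
def contractFun (s t : E.ι → Vec n → Fin E.rank → ℂ) (v : Vec n) : ℂ :=
  if h : v ≠ 0 then
    dotProduct (s (E.idx (Projectivization.mk ℂ v h)) v) (t (E.idx (Projectivization.mk ℂ v h)) v)
  else 0

theorem contractFun_eq {d : ℕ} (s : E.sections 0) (t : E.dual.sections d) (i : E.ι) {v : Vec n}
    (hv : v ∈ coneOver (E.U i)) :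
    E.contractFun s.1 t.1 v = dotProduct (s.1 i v) (t.1 i v) := by
  obtain ⟨h, hi⟩ := hv
  unfold contractFun
  rw [dif_pos h]
  set j := E.idx (Projectivization.mk ℂ v h) with hj
  have hjm : Projectivization.mk ℂ v h ∈ E.U j := E.idx_mem _
  have hs : s.1 i v = (E.g i j v).mulVec (s.1 j v) := s.2.2.2 i j v ⟨h, hi, hjm⟩
  have ht : t.1 j v = (E.g i j v).transpose.mulVec (t.1 i v) := t.2.2.2 j i v ⟨h, hjm, hi⟩
  rw [hs, ht, Matrix.mulVec_transpose, dotProduct_comm, ← Matrix.dotProduct_mulVec]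
  exact dotProduct_comm _ _

/-- The contraction map `H⁰(E) ⊗ H⁰(E^* ⊗ L) → H⁰(L)` for `L = 𝒪(d)`. -/
def contract (d : ℕ) : E.sections 0 →ₗ[ℂ] E.dual.sections d →ₗ[ℂ] globalO n d :=
  LinearMap.mk₂ ℂ
    (fun s t => ⟨E.contractFun s.1 t.1, by
      refine ⟨by simp [contractFun], ?_⟩
      rintro v ⟨hv, -⟩
      obtain ⟨i, hi⟩ := E.cover (Projectivization.mk ℂ v hv)
      have hreg : IsRegularOn d (E.U i) (fun w => ∑ a, s.1 i w a * t.1 i w a) := by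
        refine IsRegularOn.sum _ fun a => ?_
        have := (s.2.1 i a).mul (t.2.1 i a)
        rwa [zero_add] at this
      obtain ⟨k, p, q, hp, hq, hqv, h⟩ := hreg v ⟨hv, hi⟩
      obtain ⟨m, u, hu, huv, hU⟩ := E.isOpen i v ⟨hv, hi⟩
      refine ⟨k + m, p * u, q * u, ?_, hq.mul hu, ?_, ?_⟩
      · have := hp.mul hu
        rwa [show k + d + m = k + m + d by omega] at this
      · simpa using ⟨hqv, huv⟩
      · intro w hw hne
        rw [map_mul] at hne
        have h1 := left_ne_zero_of_mul hne
        have h2 := right_ne_zero_of_mul hne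
        have hwU := hU w (coneOver_univ.1 hw) h2
        rw [E.contractFun_eq s t i hwU, map_mul, map_mul, mul_div_mul_right _ _ h2, ← h w hwU h1]
        rfl⟩)
    (by
      intro s s' t
      ext v
      by_cases hv : v = 0
      · simp [contractFun, hv]
      · simp only [contractFun, hv, ne_eq, not_false_eq_true, dite_true, Submodule.coe_add,
          Pi.add_apply]
        exact add_dotProduct _ _ _)
    (by
      intro a s t
      ext v
      by_cases hv : v = 0
      · simp [contractFun, hv]
      · simp only [contractFun, hv, ne_eq, not_false_eq_true, dite_true, Submodule.coe_smul,
          Pi.smul_apply]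
        exact smul_dotProduct _ _ _)
    (by
      intro s t t'
      ext v
      by_cases hv : v = 0
      · simp [contractFun, hv]
      · simp only [contractFun, hv, ne_eq, not_false_eq_true, dite_true, Submodule.coe_add,
          Pi.add_apply]
        exact dotProduct_add _ _ _)
    (by
      intro a s t
      ext v
      by_cases hv : v = 0
      · simp [contractFun, hv]
      · simp only [contractFun, hv, ne_eq, not_false_eq_true, dite_true, Submodule.coe_smul,
          Pi.smul_apply]
        exact dotProduct_smul (α := ℂ) a _ _)

/-- The map `A_f : H⁰(E) → H⁰(E^* ⊗ L)^*`, for `L = 𝒪(d)` and `f ∈ S^d V = H⁰(L)^*`, that the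
contraction map induces: `A_f(s)(t) = f(⟨s, t⟩)`. -/
def Af (d : ℕ) (f : MvPolynomial (Fin (n + 1)) ℂ) :
    E.sections 0 →ₗ[ℂ] Module.Dual ℂ (E.dual.sections d) :=
  (LinearMap.compRight ℂ (toDual n d f)).comp (E.contract d)

theorem Af_apply (d : ℕ) (f : MvPolynomial (Fin (n + 1)) ℂ) (s : E.sections 0)
    (t : E.dual.sections d) : E.Af d f s t = toDual n d f (E.contract d s t) := rfl

/-- The base locus of a space `K` of sections of `E`: the points where all of them vanish. -/
def baseLocus (K : Submodule ℂ (E.sections 0)) : Set (PSpace n) :=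
  {z | ∀ s ∈ K, ∀ i, z ∈ E.U i → s.1 i z.rep = 0}

/-- The base locus of `K`, with its scheme structure, is a reduced point near `z`: locally at
`z`, the components of the sections in `K` generate the ideal of all the regular functions that
vanish at `z`. -/
def IsReducedPoint (K : Submodule ℂ (E.sections 0)) (z : PSpace n) : Prop :=
  z ∈ E.baseLocus K ∧
  ∀ (W : Set (PSpace n)) (h : Vec n → ℂ), IsZariskiOpen W → z ∈ W → IsRegularOn 0 W h →
    h z.rep = 0 →
    ∃ (W' : Set (PSpace n)) (i : E.ι) (m : ℕ) (s : Fin m → E.sections 0)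
      (a : Fin m → Fin E.rank) (u : Fin m → Vec n → ℂ),
      IsZariskiOpen W' ∧ z ∈ W' ∧ W' ⊆ W ∧ W' ⊆ E.U i ∧ (∀ k, s k ∈ K) ∧
      (∀ k, IsRegularOn 0 W' (u k)) ∧
      ∀ w ∈ coneOver W', h w = ∑ k, u k w * (s k).1 i w (a k)

end AlgBundle

/-! ## The general algorithm -/

/-- The solutions of the linear system `f = ∑ z ∈ Z, x z * (v_z)^d` in the unknown coefficients
`x z`, where `v_z` is a chosen representative of the point `z`.  A solution is extended by `0` to
all points of the projective space. -/
def linearSystem {n : ℕ} (d : ℕ) (f : MvPolynomial (Fin (n + 1)) ℂ) (Z : Set (PSpace n)) :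
    Set (PSpace n →₀ ℂ) :=
  {x | (x.support : Set (PSpace n)) ⊆ Z ∧
    f = ∑ z ∈ x.support, C (x z) * linForm z.rep ^ d}

/-- The elements of a set of solutions with the fewest nonzero coefficients. -/
def fewestTerms {n : ℕ} (S : Set (PSpace n →₀ ℂ)) : Set (PSpace n →₀ ℂ) :=
  {x ∈ S | ∀ y ∈ S, x.support.card ≤ y.support.card}

/-- The solution `x` gives the decomposition `∑ i, c i * (v i)^d`: up to order and rescaling, its
points are the points of the support of `x` and its summands are the nonzero terms given
by `x`. -/
def Gives {n : ℕ} (d : ℕ) (x : PSpace n →₀ ℂ) {r : ℕ} (c : Fin r → ℂ) (v : Fin r → Vec n) :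
    Prop :=
  ∃ e : Fin r ≃ x.support, ∀ i,
    (∃ h : v i ≠ 0, Projectivization.mk ℂ (v i) h = (e i).1) ∧
    C (c i) * linForm (v i) ^ d = C (x (e i).1) * linForm (e i).1.rep ^ d

open Classical in
/-- The general algorithm.  It fails (`none`) if `ker A_f` is trivial, or if the base locus `Z'`
of `ker A_f` does not consist of finitely many reduced points.  Otherwise it solves the linear
system given by the points of `Z'`, and returns the set of its solutions. -/
def bundleAlgorithm {n : ℕ} (d : ℕ) (f : MvPolynomial (Fin (n + 1)) ℂ) (E : AlgBundle n) :
    Option (Set (PSpace n →₀ ℂ)) :=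
  if LinearMap.ker (E.Af d f) = ⊥ then none
  else if (E.baseLocus (LinearMap.ker (E.Af d f))).Finite ∧
      ∀ z ∈ E.baseLocus (LinearMap.ker (E.Af d f)),
        E.IsReducedPoint (LinearMap.ker (E.Af d f)) z then
    some (linearSystem d f (E.baseLocus (LinearMap.ker (E.Af d f))))
  else none

end Waring

end

open Waring

namespace Waring

/-! Let `f` be a sum of terms `x z * (v_z)^d` over a finite set `A` of points. Since `v^d` is
evaluation at `v`, `A_f(s)(t)` is the sum over `A` of `x z * ⟨s(z), t(z)⟩`. Hence `A_f` factors as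
evaluation at `A`, into a space of dimension `|A| * rank E`, followed by a weighted pairing
(`Af_eq_weightedPairing_comp_evalAt`). If `A` comes from a minimal decomposition, the rank
hypothesis says that `rank A_f` is exactly that dimension. So the pairing is injective, every
section in `ker A_f` vanishes on `A`, and `A` lies in the base locus
(`mem_baseLocus_of_finrank_range`).

The rest is a dictionary between decompositions and finitely supported functions on `ℙ V`. A minimal
decomposition has distinct points and nonzero terms, so it is a function with exactly `waringRank d
f` nonzero values (`exists_gives`), and no solution has fewer. As minimal decompositions live on
`Z'`, the sparsest solutions on `Z'` are exactly these. The algorithm could then stop only on a zero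
kernel, but that would make `Z'` all of `ℙ V`, which is infinite for `n ≥ 1`. -/

variable {n d r : ℕ} {f : MvPolynomial (Fin (n + 1)) ℂ}

/-! ### Linear forms and chosen representatives of points -/

theorem linForm_smul (a : ℂ) (v : Vec n) : linForm (a • v) = C a * linForm v := by
  simp [linForm, Finset.mul_sum, mul_assoc]

theorem linForm_ne_zero {v : Vec n} (hv : v ≠ 0) : linForm v ≠ 0 := by
  classical
  intro h
  refine hv (funext fun i => ?_)
  have h1 := congrArg (eval (Pi.single i (1 : ℂ))) h
  simpa [linForm, Pi.single_apply] using h1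

theorem mk_rep_mem_coneOver {U : Set (PSpace n)} {z : PSpace n} (hz : z ∈ U) :
    z.rep ∈ coneOver U :=
  ⟨z.rep_nonzero, by rwa [z.mk_rep]⟩

/-- A term `c v^d` is a multiple of the `d`-th power of the chosen representative of `[v]`. -/
theorem exists_coeff_rep (d : ℕ) (c : ℂ) {v : Vec n} (hv : v ≠ 0) :
    ∃ b : ℂ, C c * linForm v ^ d =
      C b * linForm (Projectivization.mk ℂ v hv).rep ^ d := by
  obtain ⟨a, ha⟩ := Projectivization.exists_smul_eq_mk_rep ℂ v hv
  refine ⟨c * ((a⁻¹ : ℂˣ) : ℂ) ^ d, ?_⟩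
  have h : v = ((a⁻¹ : ℂˣ) : ℂ) • (Projectivization.mk ℂ v hv).rep := by
    rw [← ha]
    simp [Units.smul_def, smul_smul]
  conv_lhs => rw [h, linForm_smul, mul_pow]
  rw [map_mul, map_pow, mul_assoc]

theorem C_mul_rep_pow_injective (z : PSpace n) {a b : ℂ}
    (h : C a * linForm z.rep ^ d = C b * linForm z.rep ^ d) : a = b :=
  C_injective _ _ (mul_right_cancel₀ (pow_ne_zero d (linForm_ne_zero z.rep_nonzero)) h)

/-! ### Decompositions and solutions of the linear system -/

theorem waringRank_le {c : Fin r → ℂ} {v : Fin r → Vec n} (h : IsWaringDecomp d f c v) :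
    waringRank d f ≤ r :=
  Nat.sInf_le ⟨c, v, h⟩

/-- The length `r` is tied to the support only by an equation, so that it can be specialised to
`waringRank d f` as well as to the cardinality itself. -/
theorem exists_decomp_of_mem_linearSystem {Z : Set (PSpace n)} {x : PSpace n →₀ ℂ}
    (hx : x ∈ linearSystem d f Z) (hr : x.support.card = r) :
    ∃ (c : Fin r → ℂ) (v : Fin r → Vec n), IsWaringDecomp d f c v ∧ Gives d x c v := by
  let e : Fin r ≃ x.support := (x.support.equivFinOfCardEq hr).symm
  refine ⟨fun i => x (e i).1, fun i => (e i).1.rep, ⟨fun i => (e i).1.rep_nonzero, ?_⟩,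
    e, fun i => ⟨⟨(e i).1.rep_nonzero, (e i).1.mk_rep⟩, rfl⟩⟩
  rw [e.sum_comp (fun z : x.support => C (x z.1) * linForm z.1.rep ^ d), hx.2,
    ← Finset.sum_coe_sort]

theorem waringRank_le_card {Z : Set (PSpace n)} {x : PSpace n →₀ ℂ}
    (hx : x ∈ linearSystem d f Z) : waringRank d f ≤ x.support.card := by
  obtain ⟨c, v, h, -⟩ := exists_decomp_of_mem_linearSystem hx rfl
  exact waringRank_le h

/-- Every minimal decomposition is given by a solution of the linear system on all of `ℙ V`. -/
theorem exists_gives {c : Fin (waringRank d f) → ℂ} {v : Fin (waringRank d f) → Vec n}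
    (h : IsWaringDecomp d f c v) :
    ∃ x ∈ linearSystem d f Set.univ, Gives d x c v := by
  classical
  choose b hb using fun i => exists_coeff_rep d (c i) (h.1 i)
  let z : Fin (waringRank d f) → PSpace n := fun i => Projectivization.mk ℂ (v i) (h.1 i)
  -- Coinciding points merge in this sum, so `x` solves the system before the points are known to be
  -- distinct.
  let x : PSpace n →₀ ℂ := ∑ i, Finsupp.single (z i) (b i)
  have hx : x ∈ linearSystem d f Set.univ := by
    refine ⟨Set.subset_univ _, ?_⟩
    change f = x.sum fun z a => C a * linForm z.rep ^ d
    rw [← Finsupp.sum_finsetSum_index (by simp) (by intros; rw [map_add, add_mul])]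
    refine h.2.trans (Finset.sum_congr rfl fun i _ => ?_)
    rw [Finsupp.sum_single_index (by simp), hb i]
  have hsub : x.support ⊆ Finset.univ.image z := by
    intro w hw
    by_contra hne
    refine Finsupp.mem_support_iff.1 hw ?_
    rw [Finsupp.finsetSum_apply]
    refine Finset.sum_eq_zero fun i _ => Finsupp.single_eq_of_ne ?_
    rintro rfl
    exact hne (Finset.mem_image_of_mem _ (Finset.mem_univ i))
  -- Minimality squeezes the support between `waringRank d f` and the number of points: no two
  -- points merge and no coefficient vanishes.
  have h1 := waringRank_le_card hx
  have h2 : (Finset.univ.image z).card ≤ waringRank d f := by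
    simpa using Finset.card_image_le (s := Finset.univ) (f := z)
  have hsupp : x.support = Finset.univ.image z := Finset.eq_of_subset_of_card_le hsub (h2.trans h1)
  have hinj : Function.Injective z := by
    rw [← Set.injOn_univ, ← Finset.coe_univ, ← Finset.card_image_iff]
    rw [← hsupp, Finset.card_univ, Fintype.card_fin]
    exact le_antisymm (hsupp ▸ h2) h1
  have hmem : ∀ i, z i ∈ x.support := fun i => by simp [hsupp]
  refine ⟨x, hx, Equiv.ofBijective (fun i => ⟨z i, hmem i⟩) ⟨?_, ?_⟩, fun i => ⟨⟨h.1 i, rfl⟩, ?_⟩⟩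
  · intro i j hij
    exact hinj (congrArg Subtype.val hij)
  · rintro ⟨w, hw⟩
    rw [hsupp] at hw
    obtain ⟨i, -, rfl⟩ := Finset.mem_image.1 hw
    exact ⟨i, rfl⟩
  · have hxi : x (z i) = b i := by
      rw [Finsupp.finsetSum_apply, Finset.sum_eq_single i]
      · simp
      · intro j _ hj
        exact Finsupp.single_eq_of_ne (hinj.ne hj.symm)
      · simp
    rw [hb i]
    change _ = C (x (z i)) * linForm (z i).rep ^ d
    rw [hxi]

theorem Gives.card_eq {x : PSpace n →₀ ℂ} {c : Fin r → ℂ} {v : Fin r → Vec n}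
    (h : Gives d x c v) : x.support.card = r := by
  obtain ⟨e, -⟩ := h
  simpa using (Fintype.card_congr e).symm

/-- The decomposition fixes the support, and at each point the coefficient can be read off from the
summand, because the power of the chosen representative is nonzero. -/
theorem Gives.unique {x y : PSpace n →₀ ℂ} {c : Fin r → ℂ} {v : Fin r → Vec n}
    (hx : Gives d x c v) (hy : Gives d y c v) : x = y := by
  obtain ⟨e, he⟩ := hx
  obtain ⟨e', he'⟩ := hy
  have hpt : ∀ i, (e i).1 = (e' i).1 := fun i => by
    obtain ⟨h, h1⟩ := (he i).1
    obtain ⟨_, h2⟩ := (he' i).1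
    exact h1.symm.trans h2
  have hval : ∀ i, x (e i).1 = y (e i).1 := fun i => by
    have h := (he i).2.symm.trans (he' i).2
    rw [← hpt i] at h
    exact C_mul_rep_pow_injective _ h
  ext z
  by_cases hz : z ∈ x.support
  · simpa using hval (e.symm ⟨z, hz⟩)
  · by_cases hz' : z ∈ y.support
    · have h := hpt (e'.symm ⟨z, hz'⟩)
      rw [Equiv.apply_symm_apply] at h
      have h' := (e (e'.symm ⟨z, hz'⟩)).2
      rw [h] at h'
      exact absurd h' hz
    · rw [Finsupp.notMem_support_iff.1 hz, Finsupp.notMem_support_iff.1 hz']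

theorem Gives.sameDecomp {x : PSpace n →₀ ℂ} {c c' : Fin r → ℂ} {v v' : Fin r → Vec n}
    (h : Gives d x c v) (h' : Gives d x c' v') : SameDecomp d c v c' v' := by
  obtain ⟨e, he⟩ := h
  obtain ⟨e', he'⟩ := h'
  refine ⟨e.trans e'.symm, fun i => ?_⟩
  obtain ⟨⟨h1, h2⟩, h3⟩ := he i
  obtain ⟨⟨h1', h2'⟩, h3'⟩ := he' (e'.symm (e i))
  rw [Equiv.apply_symm_apply] at h2' h3'
  exact ⟨⟨h1, h1', h2.trans h2'.symm⟩, h3.trans h3'.symm⟩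

theorem Gives.of_sameDecomp {x : PSpace n →₀ ℂ} {c c' : Fin r → ℂ} {v v' : Fin r → Vec n}
    (h : SameDecomp d c v c' v') (h' : Gives d x c' v') : Gives d x c v := by
  obtain ⟨p, hp⟩ := h
  obtain ⟨e, he⟩ := h'
  refine ⟨p.trans e, fun i => ?_⟩
  obtain ⟨⟨h1, h1', h2⟩, h3⟩ := hp i
  obtain ⟨⟨_, h2'⟩, h3'⟩ := he (p i)
  exact ⟨⟨h1, h2.trans h2'⟩, h3.trans h3'⟩

/-! ### Kernel and base locus -/

/-- As a functional on sections, `v^d` is evaluation at `v`; this turns a decomposition into a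
weighted sum of point evaluations. -/
theorem toDual_sum_pow (A : Finset (PSpace n)) (x : PSpace n → ℂ) (s : globalO n d) :
    toDual n d (∑ z ∈ A, C (x z) * linForm z.rep ^ d) s = ∑ z ∈ A, x z * s.1 z.rep := by
  have hs : ∀ z : PSpace n, eval z.rep (sectionEquivForm n d s).1 = s.1 z.rep := fun z => by
    rw [← formToSection_apply _ z.rep_nonzero]
    exact congrArg (fun t : globalO n d => t.1 z.rep) ((sectionEquivForm n d).symm_apply_apply s)
  have hlin : apolar n d (∑ z ∈ A, C (x z) * linForm z.rep ^ d) (sectionEquivForm n d s) =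
      ∑ z ∈ A, x z * apolar n d (linForm z.rep ^ d) (sectionEquivForm n d s) := by
    simp only [apolar, LinearMap.coe_mk, AddHom.coe_mk, coeff_sum, coeff_C_mul, Finset.mul_sum,
      Finset.sum_mul]
    rw [Finset.sum_comm]
    exact Finset.sum_congr rfl fun _ _ => Finset.sum_congr rfl fun _ _ => by ring
  change apolar n d _ (sectionEquivForm n d s) = _
  rw [hlin]
  exact Finset.sum_congr rfl fun z _ => by rw [apolar_pow, hs]

namespace AlgBundle

variable (E : AlgBundle n)

/-- The values of the sections of `E ⊗ 𝒪(d)` at the representatives of finitely many points. -/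
noncomputable def evalAt (d : ℕ) (A : Finset (PSpace n)) :
    E.sections d →ₗ[ℂ] (A × Fin E.rank → ℂ) where
  toFun s p := s.1 (E.idx p.1.1) p.1.1.rep p.2
  map_add' _ _ := rfl
  map_smul' _ _ := rfl

theorem contract_apply_rep (s : E.sections 0) (t : E.dual.sections d) (z : PSpace n) :
    (E.contract d s t).1 z.rep =
      ∑ a, s.1 (E.idx z) z.rep a * t.1 (E.idx z) z.rep a :=
  E.contractFun_eq s t (E.idx z) (mk_rep_mem_coneOver (E.idx_mem z))

/-- The pairing of values at finitely many points, weighted by `x`. -/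
noncomputable def weightedPairing (d : ℕ) (A : Finset (PSpace n)) (x : PSpace n → ℂ) :
    (A × Fin E.rank → ℂ) →ₗ[ℂ] Module.Dual ℂ (E.dual.sections d) :=
  LinearMap.mk₂ ℂ (fun u (t : E.dual.sections d) =>
      ∑ p : A × Fin E.rank, x p.1.1 * (u p * t.1 (E.idx p.1.1) p.1.1.rep p.2))
    (fun _ _ _ => by simp [add_mul, mul_add, Finset.sum_add_distrib])
    (fun _ _ _ => by
      simp only [Pi.smul_apply, smul_eq_mul, Finset.mul_sum]
      exact Finset.sum_congr rfl fun _ _ => by ring)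
    (fun _ _ _ => by simp [mul_add, Finset.sum_add_distrib])
    (fun _ _ _ => by
      simp only [Submodule.coe_smul, Pi.smul_apply, smul_eq_mul, Finset.mul_sum]
      exact Finset.sum_congr rfl fun _ _ => by ring)

theorem Af_eq_weightedPairing_comp_evalAt (A : Finset (PSpace n)) (x : PSpace n → ℂ)
    (hf : f = ∑ z ∈ A, C (x z) * linForm z.rep ^ d) :
    E.Af d f = (E.weightedPairing d A x).comp (E.evalAt 0 A) := by
  ext s t
  rw [Af_apply, hf, toDual_sum_pow]
  change _ = ∑ p : A × Fin E.rank, x p.1.1 * (s.1 (E.idx p.1.1) p.1.1.rep p.2 * _)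
  rw [Fintype.sum_prod_type, ← Finset.sum_coe_sort]
  refine Finset.sum_congr rfl fun z _ => ?_
  rw [contract_apply_rep, Finset.mul_sum]

/-- The crux: `A.card * E.rank` is the largest rank that the factorization allows, and attaining it
makes the second factor injective. -/
theorem mem_baseLocus_of_finrank_range (A : Finset (PSpace n)) (x : PSpace n → ℂ)
    (hf : f = ∑ z ∈ A, C (x z) * linForm z.rep ^ d)
    (hr : Module.finrank ℂ (LinearMap.range (E.Af d f)) = A.card * E.rank) {z : PSpace n}
    (hz : z ∈ A) : z ∈ E.baseLocus (LinearMap.ker (E.Af d f)) := by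
  have hA := E.Af_eq_weightedPairing_comp_evalAt A x hf
  have hle : Module.finrank ℂ (LinearMap.range (E.Af d f)) ≤
      Module.finrank ℂ (LinearMap.range (E.weightedPairing d A x)) :=
    Submodule.finrank_mono (hA ▸ LinearMap.range_comp_le_range _ _)
  -- The rank of the pairing is at least that of `A_f`, hence at least the dimension of its own
  -- domain; rank-nullity leaves no kernel.
  have hker : LinearMap.ker (E.weightedPairing d A x) = ⊥ := by
    have h := LinearMap.finrank_range_add_finrank_ker (E.weightedPairing d A x)
    rw [Module.finrank_fintype_fun_eq_card, Fintype.card_prod, Fintype.card_coe,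
      Fintype.card_fin] at h
    exact Submodule.finrank_eq_zero.1 (by omega)
  intro s hs i hi
  have hev : E.evalAt 0 A s = 0 := by
    refine LinearMap.ker_eq_bot.1 hker ?_
    rw [map_zero, ← LinearMap.comp_apply, ← hA]
    exact hs
  have h0 : s.1 (E.idx z) z.rep = 0 := funext fun a => congrFun hev (⟨z, hz⟩, a)
  -- Vanishing in the chosen trivialization passes to every other one through the transition matrix.
  rw [s.2.2.2 i (E.idx z) z.rep (mk_rep_mem_coneOver ⟨hi, E.idx_mem z⟩), h0, Matrix.mulVec_zero]

theorem baseLocus_bot : E.baseLocus ⊥ = Set.univ := by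
  refine Set.eq_univ_of_forall fun z s hs i _ => ?_
  rw [(Submodule.mem_bot ℂ).1 hs]
  rfl

end AlgBundle

/-! ### Infinitude of projective space in positive dimension -/

theorem infinite_pSpace (hn : 0 < n) : Infinite (PSpace n) := by
  have h01 : (0 : Fin (n + 1)) ≠ Fin.last n := by
    intro h
    have := congrArg Fin.val h
    simp at this
    omega
  -- The points `[1 : a : … : a]`: the first coordinate forces the scalar to be `1`, and the last,
  -- distinct from it as `n > 0`, recovers `a`.
  let v : ℂ → Vec n := fun a i => if i = 0 then 1 else a
  have hv : ∀ a, v a ≠ 0 := fun a h => by simpa [v] using congrFun h 0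
  refine Infinite.of_injective (fun a => Projectivization.mk ℂ (v a) (hv a)) fun a b hab => ?_
  obtain ⟨u, hu⟩ := (Projectivization.mk_eq_mk_iff' ℂ _ _ _ _).1 hab
  have h0 : u = 1 := by simpa [v] using congrFun hu 0
  have h1 : u * b = a := by simpa [v, h01.symm] using congrFun hu (Fin.last n)
  rw [← h1, h0, one_mul]

end Waring

/-! ### The main theorem -/

theorem mainTheorem1 (n d : ℕ) (f : MvPolynomial (Fin (n + 1)) ℂ) (hf : f.IsHomogeneous d)
    (E : AlgBundle n) (hE : 0 < E.rank) (Z' : Set (PSpace n))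
    (hZ' : Z' = E.baseLocus (LinearMap.ker (E.Af d f)))
    (hrank : (waringRank d f : ℚ) =
      (Module.finrank ℂ (LinearMap.range (E.Af d f)) : ℚ) / (E.rank : ℚ)) :
    -- the points of every minimal decomposition lie in the base locus
    (∀ (c : Fin (waringRank d f) → ℂ) (v : Fin (waringRank d f) → Vec n),
      IsWaringDecomp d f c v → ∀ i, v i ∈ coneOver Z') ∧
    -- if the base locus is finite, the linear system recovers the minimal decompositions
    (Z'.Finite →
      (∀ (c : Fin (waringRank d f) → ℂ) (v : Fin (waringRank d f) → Vec n),
        IsWaringDecomp d f c v → ∃! x, x ∈ fewestTerms (linearSystem d f Z') ∧ Gives d x c v) ∧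
      (∀ x ∈ fewestTerms (linearSystem d f Z'),
        ∃ (c : Fin (waringRank d f) → ℂ) (v : Fin (waringRank d f) → Vec n),
          IsWaringDecomp d f c v ∧ Gives d x c v) ∧
      (∀ x, linearSystem d f Z' = {x} →
        (∃ (c : Fin (waringRank d f) → ℂ) (v : Fin (waringRank d f) → Vec n),
          IsWaringDecomp d f c v ∧ Gives d x c v ∧
          ∀ (c' : Fin (waringRank d f) → ℂ) (v' : Fin (waringRank d f) → Vec n),
            IsWaringDecomp d f c' v' → SameDecomp d c v c' v')) ∧
      (∀ (c : Fin (waringRank d f) → ℂ) (v : Fin (waringRank d f) → Vec n),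
        IsWaringDecomp d f c v →
        (∀ (c' : Fin (waringRank d f) → ℂ) (v' : Fin (waringRank d f) → Vec n),
          IsWaringDecomp d f c' v' → SameDecomp d c v c' v') →
        ∃ x, fewestTerms (linearSystem d f Z') = {x} ∧ Gives d x c v)) ∧
    -- if moreover the points of the base locus are reduced (and `ℙ V` is not a single point),
    -- the algorithm does not fail and its output is the solution set of this linear system
    (0 < n → Z'.Finite → (∀ z ∈ Z', E.IsReducedPoint (LinearMap.ker (E.Af d f)) z) →
      bundleAlgorithm d f E = some (linearSystem d f Z')) := by
  have hrk : Module.finrank ℂ (LinearMap.range (E.Af d f)) = waringRank d f * E.rank := by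
    rw [eq_div_iff (by exact_mod_cast hE.ne')] at hrank
    exact_mod_cast hrank.symm
  have hsol : ∀ (c : Fin (waringRank d f) → ℂ) (v : Fin (waringRank d f) → Vec n),
      IsWaringDecomp d f c v → ∃ x ∈ linearSystem d f Z', Gives d x c v := by
    intro c v h
    obtain ⟨x, hx, hg⟩ := exists_gives h
    refine ⟨x, ⟨fun z hz => ?_, hx.2⟩, hg⟩
    rw [hZ']
    exact E.mem_baseLocus_of_finrank_range x.support x hx.2 (by rw [hrk, hg.card_eq]) hz
  have hfew : ∀ (c : Fin (waringRank d f) → ℂ) (v : Fin (waringRank d f) → Vec n),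
      IsWaringDecomp d f c v → ∃ x ∈ fewestTerms (linearSystem d f Z'), Gives d x c v := by
    intro c v h
    obtain ⟨x, hx, hg⟩ := hsol c v h
    -- The support of `x` has `waringRank d f` points, a lower bound for all solutions.
    exact ⟨x, ⟨hx, fun y hy => hg.card_eq.trans_le (waringRank_le_card hy)⟩, hg⟩
  have hdec : ∀ x ∈ fewestTerms (linearSystem d f Z'),
      ∃ (c : Fin (waringRank d f) → ℂ) (v : Fin (waringRank d f) → Vec n),
        IsWaringDecomp d f c v ∧ Gives d x c v := by
    intro x hx
    obtain ⟨c₀, v₀, h₀, -⟩ := exists_decomp_of_mem_linearSystem hx.1 rfl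
    -- The infimum is attained because `x` itself provides a decomposition. A minimal one then gives
    -- a competitor `y` on `Z'`, which bounds the support of `x` from above.
    obtain ⟨c₁, v₁, h₁⟩ : waringRank d f ∈ {r : ℕ | ∃ (c : Fin r → ℂ) (v : Fin r → Vec n),
      IsWaringDecomp d f c v} := Nat.sInf_mem ⟨_, c₀, v₀, h₀⟩
    obtain ⟨y, hy, hg⟩ := hsol c₁ v₁ h₁
    exact exists_decomp_of_mem_linearSystem hx.1
      (le_antisymm ((hx.2 y hy).trans_eq hg.card_eq) (waringRank_le_card hx.1))
  refine ⟨fun c v h i => ?_, fun _ => ⟨fun c v h => ?_, hdec, fun x hx => ?_, fun c v h hu => ?_⟩,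
    fun hn hfin hred => ?_⟩
  · obtain ⟨x, hx, e, he⟩ := hsol c v h
    obtain ⟨hv, hz⟩ := (he i).1
    exact ⟨hv, hz ▸ hx.1 (e i).2⟩
  · obtain ⟨x, hx, hg⟩ := hfew c v h
    exact ⟨x, ⟨hx, hg⟩, fun y hy => hy.2.unique hg⟩
  · have hxf : x ∈ fewestTerms (linearSystem d f Z') := by
      rw [hx]
      refine ⟨rfl, fun y hy => ?_⟩
      rw [Set.mem_singleton_iff.1 hy]
    obtain ⟨c, v, h, hg⟩ := hdec x hxf
    refine ⟨c, v, h, hg, fun c' v' h' => ?_⟩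
    -- Any other minimal decomposition comes from a solution too, necessarily `x`.
    obtain ⟨y, hy, hg'⟩ := hsol c' v' h'
    rw [hx, Set.mem_singleton_iff] at hy
    exact hg.sameDecomp (hy ▸ hg')
  · obtain ⟨x, hx, hg⟩ := hfew c v h
    refine ⟨x, Set.eq_singleton_iff_unique_mem.2 ⟨hx, fun y hy => ?_⟩, hg⟩
    obtain ⟨c', v', h', hg'⟩ := hdec y hy
    exact (Gives.of_sameDecomp (hu c' v' h') hg').unique hg
  · subst hZ'
    -- A zero kernel would make every point a base point, against finiteness.
    have hker : LinearMap.ker (E.Af d f) ≠ ⊥ := by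
      intro h
      rw [h, E.baseLocus_bot] at hfin
      have := infinite_pSpace hn
      exact Set.infinite_univ hfin
    rw [bundleAlgorithm, if_neg hker, if_pos ⟨hfin, hred⟩]
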